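/- Let $R:\mathbb R^n\to(-\infty,+\infty]$ be proper, convex and lower semicontinuous, let $F:\mathbb R^n\to\mathbb R$ be convex and differentiable with $\frac1\beta$-Lipschitz gradient ($\beta>0$), and put $\Phi=F+R$. Let $(x_k)_{k\in\mathbb N}$ be generated, with $x_0$ arbitrary and $x_{-1}=x_0$, by $$x_{k+1}=\operatorname{prox}_{\gamma_kR}\bigl(y_{a,k}-\gamma_k\nabla F(y_{b,k})\bigr),\quad y_{a,k}=x_k+a_k(x_k-x_{k-1}),\quad y_{b,k}=x_k+b_k(x_k-x_{k-1}),$$ where $\operatorname{prox}_{\gamma R}(y)$ is the minimizer of $z\mapsto\frac12\|z-y\|^2+\gamma R(z)$, $a_k,b_k\in[0,1]$, and $\gamma_k\in[\underline\epsilon,2\beta-\overline\epsilon]$ for some $\underline\epsilon,\overline\epsilon>0$. Assume that $x_k\to x^\star$ for a global minimizer $x^\star$ of $\Phi$, and let $T=\operatorname{par}(\partial R(x^\star))^\perp$, where $\operatorname{par}(\Omega)$ is the linear subspace parallel to the affine hull of $\Omega$. Suppose that * $R$ is locally polyhedral around $x^\star$, i.e. it coincides near $x^\star$ with a function whose epigraph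 is a finite intersection of closed half-spaces, and $F$ is $C^2$ near $x^\star$; * (ND) $-\nabla F(x^\star)\in\operatorname{ri}(\partial R(x^\star))$; * (RI) $\ker(\nabla^2F(x^\star))\cap T=\{0\}$; * $a_k\to a$, $b_k\to b$, $\gamma_k\to\gamma$, with $(a,b)\neq(1,0)$. Let $G=\mathrm{Id}-\gamma\,P_T\nabla^2F(x^\star)P_T$, regarded as an operator on $T$, and let $$M=\begin{bmatrix}(a-b)\mathrm{Id}+(1+b)G&-(a-b)\mathrm{Id}-bG\\ \mathrm{Id}&0\end{bmatrix}\quad\text{on }T\times T,$$ with spectral radius $\rho(M)$ (the largest modulus of a complex eigenvalue; $0$ if $T=\{0\}$). Suppose that $\frac{2(b-a)-1}{1+2b}<\eta$ for every eigenvalue $\eta$ of $G$, i.e. $\frac{2(b-a)-1}{1+2b}<\eta_{\min}(G)$ if $T\ne\{0\}$. Then $\rho(M)<1$, and $(x_k)$ converges locally linearly to $x^\star$: for every $\rho\in(\rho(M),1)$ there are $K>0$ and $C>0$ such that $$\|x_k-x^\star\|\le C\rho^{\,k-K}\|x_K-x^\star\|\qquad\text{for all }k\ge K.$$ Moreover,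 the rate $\rho=\rho(M)$ itself is attained in this estimate when the parameters are constant ($a_k\equiv a$, $b_k\equiv b$, $\gamma_k\equiv\gamma$), provided that $\nabla^2F$ is Hölder continuous at $x^\star$, i.e. $\|\nabla^2F(y)-\nabla^2F(x^\star)\|\le L\|y-x^\star\|^{\alpha}$ near $x^\star$ for some $L$ and some $\alpha>0$ (for instance, $F$ quadratic near $x^\star$), and that every complex eigenvalue of $M$ of modulus $\rho(M)$ is semisimple. -/

import Mathlib

open Filter Topology Set

namespace FBType

noncomputable section

section Basic

variable {E : Type*} [NormedAddCommGroup E] [InnerProductSpace ℝ E]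

/-- The class `Γ₀` of proper convex lower semicontinuous functions with values in `(-∞, +∞]`. -/
structure IsGammaZero (R : E → EReal) : Prop where
  ne_bot : ∀ x, R x ≠ ⊥
  proper : ∃ x, R x ≠ ⊤
  convex : Convex ℝ {p : E × ℝ | R p.1 ≤ (p.2 : EReal)}
  lsc : LowerSemicontinuous R

/-- The convex subdifferential `∂R(x)`. -/
def subdiff (R : E → EReal) (x : E) : Set E :=
  {g | ∀ y, R x + ((inner ℝ g (y - x) : ℝ) : EReal) ≤ R y}

/-- `T_x = par(∂R(x))^⊥`, where `par Ω = ℝ(Ω - Ω)` is the direction of the affine hull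
of the convex set `Ω`. -/
def tangent (R : E → EReal) (x : E) : Submodule ℝ E :=
  (vectorSpan ℝ (subdiff R x))ᗮ

/-- A function is polyhedral if its epigraph is a finite intersection of closed half-spaces. -/
def IsPolyhedral (P : E → EReal) : Prop :=
  ∃ (m : ℕ) (u : Fin m → E) (s t : Fin m → ℝ), ∀ (x : E) (r : ℝ),
    P x ≤ (r : EReal) ↔ ∀ i, inner ℝ (u i) x + s i * r ≤ t i

/-- `R` coincides with a polyhedral function on a neighbourhood of `x`. -/
def IsLocallyPolyhedral (R : E → EReal) (x : E) : Prop :=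
  ∃ P : E → EReal, IsPolyhedral P ∧ ∀ᶠ y in 𝓝 x, R y = P y

/-- `p = prox_{γR}(y)`, i.e. `p` minimizes `z ↦ ½‖z - y‖² + γ R(z)`. -/
def IsProx (R : E → EReal) (γ : ℝ) (y p : E) : Prop :=
  IsMinOn (fun z => ((1 / 2 * ‖z - y‖ ^ 2 : ℝ) : EReal) + (γ : EReal) * R z) univ p

/-- The objective `Φ = F + R`. -/
def objective (F : E → ℝ) (R : E → EReal) (x : E) : EReal := (F x : EReal) + R x

/-- The inertial extrapolation `x_k + c (x_k - x_{k-1})`. At `k = 0` the truncated subtraction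
gives `x (0 - 1) = x 0`, which is the initialization `x_{-1} = x_0`. -/
def extrap (x : ℕ → E) (c : ℝ) (k : ℕ) : E := x k + c • (x k - x (k - 1))

/-- Local linear convergence of `x` to `z` at rate `ρ`. -/
def LinearRate (x : ℕ → E) (z : E) (ρ : ℝ) : Prop :=
  ∃ K : ℕ, 0 < K ∧ ∃ C : ℝ, 0 < C ∧ ∀ k, K ≤ k → ‖x k - z‖ ≤ C * ρ ^ (k - K) * ‖x K - z‖

/-- `F` is convex and differentiable with `1/β`-Lipschitz gradient. -/
structure IsSmoothConvex [CompleteSpace E] (F : E → ℝ) (β : ℝ) : Prop where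
  pos : 0 < β
  convex : ConvexOn ℝ univ F
  differentiable : Differentiable ℝ F
  lipschitz : ∀ x y, ‖gradient F x - gradient F y‖ ≤ 1 / β * ‖x - y‖

/-- The Hessian of `F` at `x`, as the derivative of the gradient. -/
def hessian [CompleteSpace E] (F : E → ℝ) (x : E) : E →L[ℝ] E :=
  fderiv ℝ (fun y => gradient F y) x

/-- `x` is produced by the inertial forward-backward iteration with inertial parameters
`a k`, `b k` in `[0, 1]` and step sizes `γ k` in a fixed interval `[ε₁, 2β - ε₂]`,
`ε₁, ε₂ > 0`. -/
structure IsFBSequence [CompleteSpace E] (F : E → ℝ) (R : E → EReal) (β : ℝ)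
    (a b γ : ℕ → ℝ) (x : ℕ → E) : Prop where
  a_mem : ∀ k, a k ∈ Icc (0 : ℝ) 1
  b_mem : ∀ k, b k ∈ Icc (0 : ℝ) 1
  step_mem : ∃ ε₁ ε₂ : ℝ, 0 < ε₁ ∧ 0 < ε₂ ∧ ∀ k, γ k ∈ Icc ε₁ (2 * β - ε₂)
  iterate : ∀ k, IsProx R (γ k)
    (extrap x (a k) k - γ k • gradient F (extrap x (b k) k)) (x (k + 1))

end Basic

section Matrices

variable {E : Type*} [NormedAddCommGroup E] [InnerProductSpace ℝ E] [FiniteDimensional ℝ E]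

/-- `G = Id - H` with `H = γ P_T Q P_T`, as an operator on the subspace `T`. -/
def opG (T : Submodule ℝ E) (Q : E →L[ℝ] E) (γ : ℝ) : Module.End ℝ T :=
  LinearMap.id -
    γ • (T.orthogonalProjectionOnto.toLinearMap ∘ₗ Q.toLinearMap ∘ₗ T.subtype)

/-- The block operator
`M = [(a-b) Id + (1+b) G, -(a-b) Id - b G; Id, 0]` on `V × V`. -/
def opM {V : Type*} [AddCommGroup V] [Module ℝ V] (G : Module.End ℝ V) (a b : ℝ) :
    Module.End ℝ (V × V) :=
  LinearMap.prod
    (((a - b) • LinearMap.id + (1 + b) • G) ∘ₗ LinearMap.fst ℝ V V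
      + (-(a - b) • LinearMap.id - b • G) ∘ₗ LinearMap.snd ℝ V V)
    (LinearMap.fst ℝ V V)

/-- The complexification of a real endomorphism. -/
def complexify {V : Type*} [AddCommGroup V] [Module ℝ V] (M : Module.End ℝ V) :
    Module.End ℂ (TensorProduct ℝ ℂ V) :=
  LinearMap.baseChange ℂ M

/-- The spectral radius `ρ(M)`: the largest modulus of a complex eigenvalue of `M`
(`0` on the zero space). Only used in finite dimension, where it is finite. -/
def rho {V : Type*} [AddCommGroup V] [Module ℝ V] (M : Module.End ℝ V) : ℝ :=
  (spectralRadius ℂ (complexify M)).toReal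

/-- Every complex eigenvalue of `M` of modulus `ρ(M)` is semisimple
(has no nontrivial Jordan block). -/
def PeripherallySemisimple {V : Type*} [AddCommGroup V] [Module ℝ V]
    (M : Module.End ℝ V) : Prop :=
  ∀ σ : ℂ, ‖σ‖ = rho M →
    Module.End.maxGenEigenspace (complexify M) σ = Module.End.eigenspace (complexify M) σ

end Matrices

end

end FBType

/-!
Near the solution the iteration becomes a smooth recursion on the subspace `T`. The function `R` is
affine on `x* + T` close to `x*`, because each half-space of its epigraph that is active at
`(x*, R x*)` yields a subgradient at `x*` and all subgradients agree on `T`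
(`IsLocallyPolyhedral.eventually_le`). Since `-∇F(x*)` is relatively interior, `R` grows by a fixed
multiple of the distance to `x* + T` above its affine part. The subgradients of `R` at
`x (k + 1)` produced by the proximal step converge to `-∇F(x*)`, so this growth forces
`x (k + 1) - x* ∈ T` for all large `k` (`sub_mem_tangent_of_subgradient_near`), and projecting the
optimality condition on `T` removes `R` altogether (`IsFBSequence.eventually_recursion`).

Expanding `∇F` at `x*`, two consecutive errors `d k = (x k - x*, x (k - 1) - x*)` satisfy
`d (k + 1) = M (d k) + o(‖d k‖)`. The operator `G` is symmetric with eigenvalues below `1`, by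
convexity of `F` and `ker ∇²F(x*) ∩ T = 0`. Over an eigenvector of `G` for `η`, `M` satisfies a real quadratic
equation, to which the Schur–Cohn criterion applies: its three inequalities are `η < 1`, the lower
bound on `η`, and `a - b + b η < 1`, which holds because `(a, b) ≠ (1, 0)`. Hence `ρ(M) < 1`
(`rho_opM_lt_one`).

For the rates, the decomposition into generalized eigenspaces gives `‖M ^ k‖ ≤ C ρ ^ k` for
`ρ > ρ(M)`, and for `ρ = ρ(M)` when the peripheral eigenvalues are semisimple
(`exists_pow_bound`). In the equivalent gauge `sup_k ‖M ^ k v‖ / ρ ^ k` the operator contracts by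
`ρ`, which absorbs an `o(‖d k‖)` perturbation at the cost of an arbitrarily small loss in the rate
(`exists_rate_of_rho_lt`), and a perturbation with summable relative size at no loss
(`exists_rate_of_summable`). With constant parameters and a Hölder continuous Hessian the relative
size is `O(‖d k‖ ^ α)`, which is summable by the rate already obtained.
-/

namespace FBType

/-! ### Spectral radius and growth of powers -/

section Growth

variable {V : Type*} [AddCommGroup V] [Module ℝ V]

/-- The supremum in the spectral radius is finite, so passing to real numbers loses nothing. -/
theorem norm_le_rho [FiniteDimensional ℝ V] {M : Module.End ℝ V} {σ : ℂ}
    (hσ : (complexify M).HasEigenvalue σ) :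
    ‖σ‖ ≤ rho M := by
  have hfin := Module.End.finite_spectrum (complexify M)
  have hne : spectralRadius ℂ (complexify M) ≠ ⊤ := by
    unfold spectralRadius
    obtain ⟨B, hB⟩ := (hfin.image (fun k : ℂ => ‖k‖₊)).bddAbove
    refine ne_top_of_le_ne_top (ENNReal.coe_ne_top (r := B)) ?_
    refine iSup₂_le fun k hk => ?_
    exact ENNReal.coe_le_coe.2 (hB ⟨k, hk, rfl⟩)
  have h1 : (‖σ‖₊ : ENNReal) ≤ spectralRadius ℂ (complexify M) :=
    le_iSup₂ (f := fun (k : ℂ) (_ : k ∈ spectrum ℂ (complexify M)) => (‖k‖₊ : ENNReal)) σ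
      (Module.End.hasEigenvalue_iff_mem_spectrum.1 hσ)
  have h2 := ENNReal.toReal_mono hne h1
  simpa [rho] using h2

theorem rho_lt_of_forall_eigenvalue [FiniteDimensional ℝ V] {M : Module.End ℝ V} {c : ℝ}
    (hc : 0 < c)
    (h : ∀ σ : ℂ, (complexify M).HasEigenvalue σ → ‖σ‖ < c) : rho M < c := by
  have hfin := Module.End.finite_spectrum (complexify M)
  have hlt : spectralRadius ℂ (complexify M) < ENNReal.ofReal c := by
    rcases (spectrum ℂ (complexify M)).eq_empty_or_nonempty with he | hne
    · simpa [spectralRadius, he] using hc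
    · obtain ⟨σ, hσ, hmax⟩ := Set.exists_max_image _ (fun k : ℂ => ‖k‖) hfin hne
      have h1 : spectralRadius ℂ (complexify M) ≤ ENNReal.ofReal ‖σ‖ :=
        iSup₂_le fun k hk => by
          have : (‖k‖₊ : ENNReal) = ENNReal.ofReal ‖k‖ := (ofReal_norm k).symm
          rw [this]
          exact ENNReal.ofReal_le_ofReal (hmax k hk)
      exact h1.trans_lt ((ENNReal.ofReal_lt_ofReal_iff hc).2
        (h σ (Module.End.hasEigenvalue_iff_mem_spectrum.2 hσ)))
  have := (ENNReal.toReal_lt_toReal (ne_top_of_lt hlt) ENNReal.ofReal_ne_top).2 hlt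
  rwa [ENNReal.toReal_ofReal hc.le] at this

theorem rho_nonneg (M : Module.End ℝ V) : 0 ≤ rho M := ENNReal.toReal_nonneg

theorem exists_bound_of_recursion {c c' : ℕ → ℂ} {μ : ℂ} {ρ C : ℝ} (hμ : ‖μ‖ < ρ)
    (hrec : ∀ k, c (k + 1) = μ * c k + c' k) (hc' : ∀ k, ‖c' k‖ ≤ C * ρ ^ k) :
    ∃ D, ∀ k, ‖c k‖ ≤ D * ρ ^ k := by
  have hρ : 0 ≤ ρ := (norm_nonneg _).trans hμ.le
  -- `D` is a supersolution: `‖μ‖ D + C ≤ D ρ`.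
  refine ⟨max ‖c 0‖ (C / (ρ - ‖μ‖)), fun k => ?_⟩
  set D := max ‖c 0‖ (C / (ρ - ‖μ‖))
  have hD : C ≤ D * (ρ - ‖μ‖) :=
    (div_le_iff₀ (by linarith)).1 (le_max_right _ _)
  induction k with
  | zero => rw [pow_zero, mul_one]; exact le_max_left _ _
  | succ k ih =>
    calc ‖c (k + 1)‖ ≤ ‖μ‖ * ‖c k‖ + ‖c' k‖ := by
          rw [hrec, ← norm_mul]; exact norm_add_le _ _
      _ ≤ ‖μ‖ * (D * ρ ^ k) + C * ρ ^ k := by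
          gcongr
          exact hc' k
      _ = (‖μ‖ * D + C) * ρ ^ k := by ring
      _ ≤ (D * ρ) * ρ ^ k := by
          gcongr
          linarith
      _ = D * ρ ^ (k + 1) := by ring

/-- The vectors whose orbit under `A` grows at most like `ρ ^ k`. Growth is tested against linear
functionals, so that no norm on the space has to be chosen. -/
def growthSubmodule {W : Type*} [AddCommGroup W] [Module ℂ W] (A : Module.End ℂ W) (ρ : ℝ) :
    Submodule ℂ W where
  carrier := {v | ∀ φ : W →ₗ[ℂ] ℂ, ∃ C : ℝ, ∀ k : ℕ, ‖φ ((A ^ k) v)‖ ≤ C * ρ ^ k}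
  zero_mem' := fun φ => ⟨0, fun k => by simp⟩
  add_mem' := by
    intro u v hu hv φ
    obtain ⟨C, hC⟩ := hu φ
    obtain ⟨D, hD⟩ := hv φ
    refine ⟨C + D, fun k => ?_⟩
    rw [map_add, map_add, add_mul]
    exact (norm_add_le _ _).trans (add_le_add (hC k) (hD k))
  smul_mem' := by
    intro c v hv φ
    obtain ⟨C, hC⟩ := hv φ
    refine ⟨‖c‖ * C, fun k => ?_⟩
    rw [map_smul, map_smul, norm_smul, mul_assoc]
    exact mul_le_mul_of_nonneg_left (hC k) (norm_nonneg _)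

/-- Eigenvalues of modulus exactly `ρ` are allowed when they are semisimple. -/
theorem growthSubmodule_eq_top {W : Type*} [AddCommGroup W] [Module ℂ W] [FiniteDimensional ℂ W]
    {A : Module.End ℂ W} {ρ : ℝ}
    (h : ∀ σ : ℂ, A.HasEigenvalue σ →
      ‖σ‖ < ρ ∨ (‖σ‖ = ρ ∧ A.maxGenEigenspace σ = A.eigenspace σ)) :
    growthSubmodule A ρ = ⊤ := by
  rw [eq_top_iff, ← Module.End.iSup_maxGenEigenspace_eq_top A]
  refine iSup_le fun σ => ?_
  by_cases hσ : A.HasEigenvalue σ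
  · rcases h σ hσ with hlt | ⟨heq, hss⟩
    · intro v hv
      obtain ⟨m, hm⟩ := (Module.End.mem_maxGenEigenspace A σ v).1 hv
      clear hv
      induction m generalizing v with
      | zero =>
        have hv0 : v = 0 := by simpa using hm
        rw [hv0]; exact zero_mem _
      | succ m ih =>
        have hv' : (A - σ • (1 : Module.End ℂ W)) v ∈ growthSubmodule A ρ := by
          apply ih
          rwa [pow_succ, Module.End.mul_apply] at hm
        intro φ
        obtain ⟨C, hC⟩ := hv' φ
        refine exists_bound_of_recursion hlt (fun k => ?_) hC
        have : (A - σ • (1 : Module.End ℂ W)) v = A v - σ • v := by simp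
        rw [this, map_sub, map_smul, map_sub, map_smul, pow_succ, Module.End.mul_apply]
        simp
    · rw [hss]
      intro v hv φ
      have hAv : ∀ k : ℕ, (A ^ k) v = σ ^ k • v := by
        intro k
        induction k with
        | zero => simp
        | succ k ih =>
          rw [pow_succ', Module.End.mul_apply, ih, map_smul, Module.End.mem_eigenspace_iff.1 hv,
            smul_smul, pow_succ]
      refine ⟨‖φ v‖, fun k => ?_⟩
      rw [hAv, map_smul, norm_smul, norm_pow, heq, mul_comm]
  · have : A.maxGenEigenspace σ = ⊥ := by
      by_contra hne
      exact hσ (Module.End.HasUnifEigenvalue.lt (k := ⊤) (m := 1) one_pos hne)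
    rw [this]; exact bot_le

end Growth

section PowerBound

variable {V : Type*} [NormedAddCommGroup V] [NormedSpace ℝ V]

theorem complexify_pow_apply (M : Module.End ℝ V) (k : ℕ) (u : V) :
    ((complexify M) ^ k) ((1 : ℂ) ⊗ₜ[ℝ] u) = (1 : ℂ) ⊗ₜ[ℝ] ((M ^ k) u) := by
  induction k with
  | zero => simp
  | succ k ih =>
    rw [pow_succ', Module.End.mul_apply, ih, pow_succ', Module.End.mul_apply]
    simp [complexify]

/-- Uniform bound on the powers of a real operator, deduced entrywise in a basis from the growth of
the orbits of its complexification. -/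
theorem exists_pow_bound [FiniteDimensional ℝ V] {M : Module.End ℝ V} {ρ : ℝ} (hρ : 0 ≤ ρ)
    (h : ∀ σ : ℂ, (complexify M).HasEigenvalue σ →
      ‖σ‖ < ρ ∨ (‖σ‖ = ρ ∧
        (complexify M).maxGenEigenspace σ = (complexify M).eigenspace σ)) :
    ∃ C : ℝ, 0 < C ∧ ∀ (k : ℕ) (v : V), ‖(M ^ k) v‖ ≤ C * ρ ^ k * ‖v‖ := by
  let B := Module.finBasis ℝ V
  -- Bounds for the entries of the matrices of the powers.
  have hentry : ∀ i j, ∃ C : ℝ, ∀ k : ℕ, ‖B.coord i ((M ^ k) (B j))‖ ≤ C * ρ ^ k := by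
    intro i j
    have hmem : (1 : ℂ) ⊗ₜ[ℝ] (B j) ∈ growthSubmodule (complexify M) ρ := by
      rw [growthSubmodule_eq_top h]; trivial
    obtain ⟨C, hC⟩ := hmem ((B.baseChange ℂ).coord i)
    refine ⟨C, fun k => ?_⟩
    have := hC k
    rw [complexify_pow_apply] at this
    simpa using this
  choose C hC using hentry
  have hK : ∀ j, ∃ K : ℝ, ∀ v, ‖B.coord j v‖ ≤ K * ‖v‖ := fun j =>
    ⟨‖LinearMap.toContinuousLinearMap (B.coord j)‖,
      fun v => (LinearMap.toContinuousLinearMap (B.coord j)).le_opNorm v⟩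
  choose K hK using hK
  have hC0 : ∀ i j, 0 ≤ C i j := fun i j => by
    simpa using (norm_nonneg _).trans (hC i j 0)
  set S : ℝ := ∑ j, ∑ i, K j * C i j * ‖B i‖ with hS
  refine ⟨max S 1, by positivity, fun k v => ?_⟩
  have h1 : (M ^ k) v = ∑ j, ∑ i, (B.coord j v * B.coord i ((M ^ k) (B j))) • B i := by
    conv_lhs => rw [← B.sum_repr v]
    rw [map_sum]
    refine Finset.sum_congr rfl fun j _ => ?_
    rw [map_smul]
    conv_lhs => rw [← B.sum_repr ((M ^ k) (B j))]
    rw [Finset.smul_sum]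
    simp [smul_smul]
  calc ‖(M ^ k) v‖ ≤ ∑ j, ∑ i, (K j * ‖v‖) * (C i j * ρ ^ k) * ‖B i‖ := by
        rw [h1]
        refine (norm_sum_le _ _).trans (Finset.sum_le_sum fun j _ => ?_)
        refine (norm_sum_le _ _).trans (Finset.sum_le_sum fun i _ => ?_)
        rw [norm_smul, norm_mul]
        have := hK j v
        have := hC i j k
        have : 0 ≤ K j * ‖v‖ := (norm_nonneg _).trans (hK j v)
        gcongr
    _ = S * ρ ^ k * ‖v‖ := by
        rw [hS, Finset.sum_mul, Finset.sum_mul]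
        refine Finset.sum_congr rfl fun j _ => ?_
        rw [Finset.sum_mul, Finset.sum_mul]
        exact Finset.sum_congr rfl fun i _ => by ring
    _ ≤ max S 1 * ρ ^ k * ‖v‖ := by
        gcongr
        exact le_max_left _ _

/-! ### Perturbed linear recursions -/

/-- The gauge `v ↦ sup_k ‖M ^ k v‖ / ρ ^ k`: an equivalent (semi)norm in which `M` contracts by the
factor `ρ`. -/
theorem exists_adapted_gauge {M : Module.End ℝ V} {ρ C : ℝ} (hρ : 0 < ρ)
    (hC : ∀ (k : ℕ) (v : V), ‖(M ^ k) v‖ ≤ C * ρ ^ k * ‖v‖) :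
    ∃ N : V → ℝ, (∀ v, ‖v‖ ≤ N v) ∧ (∀ v, N v ≤ C * ‖v‖) ∧
      (∀ u v, N (u + v) ≤ N u + N v) ∧ ∀ v, N (M v) ≤ ρ * N v := by
  have hle : ∀ (v : V) (k : ℕ), ‖(M ^ k) v‖ / ρ ^ k ≤ C * ‖v‖ := fun v k => by
    rw [div_le_iff₀ (by positivity)]
    linarith [hC k v]
  have hbdd : ∀ v : V, BddAbove (range fun k : ℕ => ‖(M ^ k) v‖ / ρ ^ k) := fun v =>
    ⟨C * ‖v‖, by rintro _ ⟨k, rfl⟩; exact hle v k⟩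
  refine ⟨fun v => ⨆ k : ℕ, ‖(M ^ k) v‖ / ρ ^ k, fun v => ?_, fun v => ciSup_le (hle v),
    fun u v => ciSup_le fun k => ?_, fun v => ciSup_le fun k => ?_⟩
  · simpa using le_ciSup (hbdd v) 0
  · refine le_trans ?_ (add_le_add (le_ciSup (hbdd u) k) (le_ciSup (hbdd v) k))
    rw [map_add, ← add_div]
    gcongr
    exact norm_add_le _ _
  · have := le_ciSup (hbdd v) (k + 1)
    calc ‖(M ^ k) (M v)‖ / ρ ^ k = ρ * (‖(M ^ (k + 1)) v‖ / ρ ^ (k + 1)) := by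
          rw [pow_succ M, Module.End.mul_apply, pow_succ ρ]
          field_simp
      _ ≤ _ := by gcongr

theorem gauge_step {M : Module.End ℝ V} {ρ C : ℝ} {N : V → ℝ} (hC : 0 < C)
    (h1 : ∀ v, ‖v‖ ≤ N v) (h2 : ∀ v, N v ≤ C * ‖v‖) (h3 : ∀ u v, N (u + v) ≤ N u + N v)
    (h4 : ∀ v, N (M v) ≤ ρ * N v) {u v : V} {δ : ℝ} (hδ : 0 ≤ δ) (h : ‖u - M v‖ ≤ δ * ‖v‖) :
    N u ≤ (ρ + C * δ) * N v := by
  calc N u = N (M v + (u - M v)) := by rw [add_sub_cancel]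
    _ ≤ ρ * N v + C * ‖u - M v‖ := (h3 _ _).trans (add_le_add (h4 v) (h2 _))
    _ ≤ ρ * N v + C * (δ * N v) := by
        gcongr
        exact h.trans (by gcongr; exact h1 v)
    _ = _ := by ring

/-- The powers are bounded at a rate strictly between `ρ(M)` and `ρ`; the gap absorbs the
perturbation. -/
theorem exists_rate_of_rho_lt [FiniteDimensional ℝ V] {M : Module.End ℝ V} {ρ : ℝ}
    (hρ : rho M < ρ) {d : ℕ → V}
    (hd : (fun k => d (k + 1) - M (d k)) =o[atTop] d) :
    ∃ C : ℝ, 0 < C ∧ ∀ᶠ K in atTop, ∀ k, K ≤ k → ‖d k‖ ≤ C * ρ ^ (k - K) * ‖d K‖ := by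
  obtain ⟨ρ', h1, h2⟩ := exists_between hρ
  have hρ' : 0 < ρ' := (rho_nonneg M).trans_lt h1
  obtain ⟨C, hC0, hC⟩ := exists_pow_bound (M := M) hρ'.le
    (fun σ hσ => Or.inl ((norm_le_rho hσ).trans_lt h1))
  obtain ⟨N, hN1, hN2, hN3, hN4⟩ := exists_adapted_gauge hρ' hC
  refine ⟨C, hC0, ?_⟩
  have hδ : 0 < (ρ - ρ') / C := div_pos (by linarith) hC0
  obtain ⟨K₀, hK₀⟩ := eventually_atTop.1 (hd.bound hδ)
  filter_upwards [eventually_ge_atTop K₀] with K hK k hk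
  have key : N (d k) ≤ ρ ^ (k - K) * N (d K) := by
    induction k, hk using Nat.le_induction with
    | base => simp
    | succ k hk ih =>
      have h5 := gauge_step hC0 hN1 hN2 hN3 hN4 hδ.le (hK₀ k (hK.trans hk))
      have h6 : ρ' + C * ((ρ - ρ') / C) = ρ := by field_simp; ring
      rw [h6] at h5
      calc N (d (k + 1)) ≤ ρ * N (d k) := h5
        _ ≤ ρ * (ρ ^ (k - K) * N (d K)) := by
            have : 0 ≤ ρ := hρ'.le.trans h2.le
            gcongr
        _ = ρ ^ (k + 1 - K) * N (d K) := by
            rw [Nat.succ_sub hk, pow_succ]; ring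
  calc ‖d k‖ ≤ ρ ^ (k - K) * N (d K) := (hN1 _).trans key
    _ ≤ ρ ^ (k - K) * (C * ‖d K‖) := by
        have : 0 ≤ ρ := hρ'.le.trans h2.le
        gcongr
        exact hN2 _
    _ = _ := by ring

/-- With summable relative errors the rate of the unperturbed recursion is kept: the factors
`1 + C δ k / ρ` have a bounded product. -/
theorem exists_rate_of_summable {M : Module.End ℝ V} {ρ C : ℝ} (hρ : 0 < ρ) (hC0 : 0 < C)
    (hC : ∀ (k : ℕ) (v : V), ‖(M ^ k) v‖ ≤ C * ρ ^ k * ‖v‖) {d : ℕ → V}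
    {δ : ℕ → ℝ} (hδ0 : ∀ k, 0 ≤ δ k) (hδ : Summable δ)
    (hd : ∀ᶠ k in atTop, ‖d (k + 1) - M (d k)‖ ≤ δ k * ‖d k‖) :
    ∃ C' : ℝ, 0 < C' ∧ ∀ᶠ K in atTop, ∀ k, K ≤ k → ‖d k‖ ≤ C' * ρ ^ (k - K) * ‖d K‖ := by
  obtain ⟨N, hN1, hN2, hN3, hN4⟩ := exists_adapted_gauge hρ hC
  set S : ℝ := Real.exp (C / ρ * ∑' i, δ i)
  refine ⟨S * C, by positivity, ?_⟩
  obtain ⟨K₀, hK₀⟩ := eventually_atTop.1 hd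
  filter_upwards [eventually_ge_atTop K₀] with K hK k hk
  have hNK : 0 ≤ N (d K) := (norm_nonneg _).trans (hN1 _)
  have key : N (d k) ≤ Real.exp (C / ρ * ∑ i ∈ Finset.range k, δ i) * ρ ^ (k - K) * N (d K) := by
    induction k, hk using Nat.le_induction with
    | base =>
      simp only [Nat.sub_self, pow_zero, mul_one]
      refine le_mul_of_one_le_left hNK (Real.one_le_exp ?_)
      have : 0 ≤ ∑ i ∈ Finset.range K, δ i := Finset.sum_nonneg fun i _ => hδ0 i
      positivity
    | succ k hk ih =>
      have hδk := hδ0 k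
      have hNk : 0 ≤ N (d k) := (norm_nonneg _).trans (hN1 _)
      calc N (d (k + 1)) ≤ (ρ + C * δ k) * N (d k) :=
            gauge_step hC0 hN1 hN2 hN3 hN4 (hδ0 k) (hK₀ k (hK.trans hk))
        _ = (C / ρ * δ k + 1) * ρ * N (d k) := by field_simp; ring
        _ ≤ Real.exp (C / ρ * δ k) * ρ *
            (Real.exp (C / ρ * ∑ i ∈ Finset.range k, δ i) * ρ ^ (k - K) * N (d K)) := by
            have := Real.add_one_le_exp (C / ρ * δ k)
            gcongr
        _ = _ := by
            rw [Finset.sum_range_succ, mul_add, Real.exp_add, Nat.succ_sub hk, pow_succ]; ring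
  have hsum : ∑ i ∈ Finset.range k, δ i ≤ ∑' i, δ i := hδ.sum_le_tsum _ fun i _ => hδ0 i
  calc ‖d k‖ ≤ _ := (hN1 _).trans key
    _ ≤ S * ρ ^ (k - K) * (C * ‖d K‖) := by
        have := hN2 (d K)
        simp only [S]
        gcongr
    _ = _ := by ring

end PowerBound

/-! ### The spectrum of the block operator -/

/-- The Schur–Cohn (Jury) criterion for real quadratics. -/
theorem norm_lt_one_of_quadratic {p q : ℝ} {σ : ℂ} (hσ : σ ^ 2 - p * σ + q = 0)
    (hq : q < 1) (h1 : 0 < 1 + q - p) (h2 : 0 < 1 + q + p) : ‖σ‖ < 1 := by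
  rw [← sq_lt_one_iff₀ (norm_nonneg _), ← Complex.normSq_eq_norm_sq, Complex.normSq_apply]
  have hre := congrArg Complex.re hσ
  have him := congrArg Complex.im hσ
  simp [pow_two] at hre him
  have him' : σ.im * (2 * σ.re - p) = 0 := by linarith
  rcases mul_eq_zero.1 him' with h | h
  · -- A real root: the parabola is positive at `±1` and the other root is `p - σ`.
    rw [h] at hre ⊢
    have hlt : σ.re < 1 := by
      by_contra! hge
      nlinarith [mul_nonneg (sub_nonneg.2 hge) (sub_nonneg.2 hge)]
    have hgt : -1 < σ.re := by
      by_contra! hle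
      nlinarith
    nlinarith
  · -- A pair of conjugate roots: their product is `q`.
    have : p = 2 * σ.re := by linarith
    rw [this] at hre
    nlinarith

section Block

variable {T : Type*} [NormedAddCommGroup T] [InnerProductSpace ℝ T] [FiniteDimensional ℝ T]

theorem opM_apply {V : Type*} [AddCommGroup V] [Module ℝ V] (G : Module.End ℝ V) (a b : ℝ)
    (w : V × V) :
    opM G a b w =
      ((a - b) • w.1 + (1 + b) • G w.1 + (-(a - b) • w.2 - b • G w.2), w.1) := rfl

open Polynomial in
/-- Over an eigenvector of `G` with eigenvalue `η` the block operator satisfies the quadratic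
equation `σ² - ((a - b) + (1 + b) η) σ + ((a - b) + b η) = 0`. Since `G` is diagonalizable, the
product of these quadratics annihilates `M`, hence also its complexification. -/
theorem exists_quadratic_of_eigenvalue {G : Module.End ℝ T} (hG : LinearMap.IsSymmetric G)
    (a b : ℝ) {σ : ℂ} (hσ : (complexify (opM G a b)).HasEigenvalue σ) :
    ∃ η : ℝ, G.HasEigenvalue η ∧
      σ ^ 2 - ((a - b + (1 + b) * η : ℝ) : ℂ) * σ + ((a - b + b * η : ℝ) : ℂ) = 0 := by
  let B := hG.eigenvectorBasis rfl
  let ev := hG.eigenvalues rfl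
  have hB : ∀ i, G (B i) = ev i • B i := fun i => hG.apply_eigenvectorBasis rfl i
  let quad : ℝ → ℝ[X] := fun η => X ^ 2 - C (a - b + (1 + b) * η) * X + C (a - b + b * η)
  let f : ℝ[X] := ∏ i, quad (ev i)
  have hquad : ∀ i, aeval (opM G a b) (quad (ev i)) (B i, 0) = 0 ∧
      aeval (opM G a b) (quad (ev i)) (0, B i) = 0 := by
    intro i
    constructor <;>
    · simp only [quad, map_add, map_sub, map_mul, aeval_X, aeval_C,
        LinearMap.add_apply, LinearMap.sub_apply, Module.End.mul_apply, pow_two,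
        Module.algebraMap_end_apply, opM_apply, hB, map_smul, map_zero, smul_zero,
        Prod.smul_mk, Prod.mk_add_mk, Prod.mk_sub_mk, Prod.mk_eq_zero]
      constructor <;> module
  have hf : aeval (opM G a b) f = 0 := by
    have hfi : ∀ i w, aeval (opM G a b) (quad (ev i)) w = 0 → aeval (opM G a b) f w = 0 := by
      intro i w hw
      have : f = (∏ j ∈ Finset.univ.erase i, quad (ev j)) * quad (ev i) :=
        (Finset.prod_erase_mul _ _ (Finset.mem_univ i)).symm
      rw [this, map_mul, Module.End.mul_apply, hw, map_zero]
    apply LinearMap.prod_ext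
    · exact B.toBasis.ext fun i => by simpa using hfi i _ (hquad i).1
    · exact B.toBasis.ext fun i => by simpa using hfi i _ (hquad i).2
  obtain ⟨w, hw⟩ := hσ.exists_hasEigenvector
  have h0 : aeval (complexify (opM G a b)) f = 0 := by
    have h := aeval_algHom_apply (Module.End.baseChangeHom ℝ ℂ (T × T)) (opM G a b) f
    rw [hf, map_zero] at h
    exact h
  have hroot : aeval σ f = 0 := by
    have h := Module.End.aeval_apply_of_hasEigenvector (p := f.map (algebraMap ℝ ℂ)) hw
    rw [aeval_map_algebraMap, h0, LinearMap.zero_apply, eval_map_algebraMap] at h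
    exact (smul_eq_zero.1 h.symm).resolve_right hw.2
  simp only [f, map_prod] at hroot
  obtain ⟨i, -, hi⟩ := Finset.prod_eq_zero_iff.1 hroot
  refine ⟨ev i, ?_, ?_⟩
  · exact Module.End.hasEigenvalue_of_hasEigenvector
      (Module.End.hasEigenvector_iff.2 ⟨Module.End.mem_eigenspace_iff.2 (hB i),
        B.orthonormal.ne_zero i⟩)
  · simpa [quad] using hi

theorem rho_opM_lt_one {G : Module.End ℝ T} (hG : LinearMap.IsSymmetric G) {a b : ℝ}
    (ha : a ∈ Icc (0 : ℝ) 1) (hb : b ∈ Icc (0 : ℝ) 1) (hab : ¬(a = 1 ∧ b = 0))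
    (hlt : ∀ η : ℝ, G.HasEigenvalue η → η < 1)
    (hspec : ∀ η : ℝ, G.HasEigenvalue η → (2 * (b - a) - 1) / (1 + 2 * b) < η) :
    rho (opM G a b) < 1 := by
  refine rho_lt_of_forall_eigenvalue one_pos fun σ hσ => ?_
  obtain ⟨η, hη, hq⟩ := exists_quadratic_of_eigenvalue hG a b hσ
  have h1 := hlt η hη
  have h2 := (div_lt_iff₀ (by linarith [hb.1])).1 (hspec η hη)
  refine norm_lt_one_of_quadratic hq ?_ (by linarith) (by linarith)
  rcases hb.1.eq_or_lt with hb0 | hb0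
  · have : a ≠ 1 := fun h => hab ⟨h, hb0.symm⟩
    have := lt_of_le_of_ne ha.2 this
    rw [← hb0]; linarith
  · nlinarith [ha.2]

end Block

/-! ### Subgradients, proximal points and identification of the active subspace -/

section Convex

variable {E : Type*} [NormedAddCommGroup E] [InnerProductSpace ℝ E]

theorem IsGammaZero.exists_coe_of_ne_top {R : E → EReal} (hR : IsGammaZero R) {x : E}
    (h : R x ≠ ⊤) : ∃ r : ℝ, R x = r :=
  ⟨(R x).toReal, (EReal.coe_toReal h (hR.ne_bot x)).symm⟩

theorem IsGammaZero.exists_coe_of_mem_subdiff {R : E → EReal} (hR : IsGammaZero R) {x g : E}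
    (hg : g ∈ subdiff R x) : ∃ r : ℝ, R x = r := by
  refine hR.exists_coe_of_ne_top fun h => ?_
  obtain ⟨y, hy⟩ := hR.proper
  have := hg y
  rw [h, EReal.top_add_coe, top_le_iff] at this
  exact hy this

theorem mem_subdiff_iff {R : E → EReal} {x g : E} {rx : ℝ} (hx : R x = rx) :
    g ∈ subdiff R x ↔ ∀ (y : E) (r : ℝ), R y ≤ r → rx + inner ℝ g (y - x) ≤ r := by
  constructor
  · intro hg y r hy
    have := (hg y).trans hy
    rw [hx] at this
    exact_mod_cast this
  · intro h y
    rw [hx, ← EReal.coe_add]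
    induction hy : R y with
    | bot =>
      have := h y (rx + inner ℝ g (y - x) - 1) (by rw [hy]; exact bot_le)
      linarith
    | coe r => exact_mod_cast h y r hy.le
    | top => exact le_top

theorem nonneg_of_forall_add_mul_nonneg {A B : ℝ} (h : ∀ t : ℝ, 0 < t → t ≤ 1 → 0 ≤ A + t * B) :
    0 ≤ A := by
  have hlim : Tendsto (fun t : ℝ => A + t * B) (𝓝[>] 0) (𝓝 (A + 0 * B)) :=
    ((continuous_const.add (continuous_id.mul continuous_const)).tendsto 0).mono_left
      nhdsWithin_le_nhds
  have := ge_of_tendsto hlim (by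
    filter_upwards [Ioo_mem_nhdsGT (zero_lt_one (α := ℝ))] with t ht using h t ht.1 ht.2.le)
  simpa using this

theorem IsGammaZero.le_segment {R : E → EReal} (hR : IsGammaZero R) {x y : E} {rx r t : ℝ}
    (hx : R x ≤ rx) (hy : R y ≤ r) (h0 : 0 ≤ t) (h1 : t ≤ 1) :
    R (x + t • (y - x)) ≤ ((rx + t * (r - rx) : ℝ) : EReal) := by
  have := hR.convex.add_smul_sub_mem (x := (x, rx)) (y := (y, r)) hx hy ⟨h0, h1⟩
  simpa using this

/-- Fermat's rule for the proximal subproblem. -/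
theorem IsProx.smul_sub_mem_subdiff {R : E → EReal} (hR : IsGammaZero R) {γ : ℝ} (hγ : 0 < γ)
    {y p : E} (h : IsProx R γ y p) : γ⁻¹ • (y - p) ∈ subdiff R p := by
  have hmin : ∀ z, ((1 / 2 * ‖p - y‖ ^ 2 : ℝ) : EReal) + (γ : EReal) * R p ≤
      ((1 / 2 * ‖z - y‖ ^ 2 : ℝ) : EReal) + (γ : EReal) * R z := fun z => h (mem_univ z)
  have hmin' : ∀ z (r : ℝ), R z ≤ r → ((1 / 2 * ‖p - y‖ ^ 2 : ℝ) : EReal) + (γ : EReal) * R p ≤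
      ((1 / 2 * ‖z - y‖ ^ 2 + γ * r : ℝ) : EReal) := by
    intro z r hz
    refine (hmin z).trans ?_
    rw [EReal.coe_add, EReal.coe_mul γ r]
    exact add_le_add le_rfl (mul_le_mul_of_nonneg_left hz (by exact_mod_cast hγ.le))
  obtain ⟨rp, hrp⟩ : ∃ r : ℝ, R p = r := by
    refine hR.exists_coe_of_ne_top fun htop => ?_
    obtain ⟨z, hz⟩ := hR.proper
    obtain ⟨r, hr⟩ := hR.exists_coe_of_ne_top hz
    have := hmin' z r hr.le
    rw [htop, EReal.coe_mul_top_of_pos hγ, EReal.coe_add_top, top_le_iff] at this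
    exact EReal.coe_ne_top _ this
  rw [mem_subdiff_iff hrp]
  intro z r hz
  have key : 0 ≤ inner ℝ (p - y) (z - p) + γ * (r - rp) := by
    refine nonneg_of_forall_add_mul_nonneg (B := 1 / 2 * ‖z - p‖ ^ 2) fun t ht ht1 => ?_
    have h1 := hmin' _ _ (hR.le_segment hrp.le hz ht.le ht1)
    rw [hrp] at h1
    have h2 : 1 / 2 * ‖p - y‖ ^ 2 + γ * rp ≤
      1 / 2 * ‖p + t • (z - p) - y‖ ^ 2 + γ * (rp + t * (r - rp)) := by exact_mod_cast h1
    have h3 : p + t • (z - p) - y = (p - y) + t • (z - p) := by abel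
    rw [h3, norm_add_sq_real, inner_smul_right, norm_smul, Real.norm_of_nonneg ht.le] at h2
    refine nonneg_of_mul_nonneg_right (a := t) ?_ ht
    nlinarith
  have h4 : inner ℝ (γ⁻¹ • (y - p)) (z - p) = -(γ⁻¹ * inner ℝ (p - y) (z - p)) := by
    rw [real_inner_smul_left, ← neg_sub p y, inner_neg_left]; ring
  rw [h4]
  have h5 : 0 ≤ γ⁻¹ * (inner ℝ (p - y) (z - p) + γ * (r - rp)) := by positivity
  rw [mul_add, inv_mul_cancel_left₀ hγ.ne'] at h5
  linarith

theorem inner_eq_of_mem_tangent {R : E → EReal} {x g v d : E} (hg : g ∈ subdiff R x)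
    (hv : v ∈ subdiff R x) (hd : d ∈ tangent R x) : inner ℝ v d = inner ℝ g d := by
  have := (Submodule.mem_orthogonal _ d).1 hd _ (vsub_mem_vectorSpan ℝ hv hg)
  rw [vsub_eq_sub, inner_sub_left] at this
  linarith

/-- A locally polyhedral function is affine on `x + T` near `x`: each half-space which is active at
`(x, R x)` yields a subgradient, `-u / s` if it is not vertical and `g + u` if it is, and all
subgradients agree on `T`. -/
theorem IsLocallyPolyhedral.eventually_le {R : E → EReal} (hR : IsGammaZero R) {x g : E}
    (hpoly : IsLocallyPolyhedral R x) (hg : g ∈ subdiff R x) {rx : ℝ} (hx : R x = rx) :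
    ∀ᶠ y in 𝓝 x, y - x ∈ tangent R x → R y ≤ ((rx + inner ℝ g (y - x) : ℝ) : EReal) := by
  obtain ⟨P, ⟨m, u, s, t, hP⟩, hRP⟩ := hpoly
  have hxP : ∀ i, inner ℝ (u i) x + s i * rx ≤ t i :=
    (hP x rx).1 (by rw [← hRP.self_of_nhds, hx])
  have hall : ∀ i, ∀ᶠ y in 𝓝 x, y - x ∈ tangent R x →
      inner ℝ (u i) y + s i * (rx + inner ℝ g (y - x)) ≤ t i := by
    intro i
    rcases (hxP i).lt_or_eq with hlt | heq
    · have hcont : Continuous fun y => inner ℝ (u i) y + s i * (rx + inner ℝ g (y - x)) := by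
        fun_prop
      have := hcont.tendsto x
      simp only [sub_self, inner_zero_right, add_zero] at this
      exact (this.eventually_lt_const hlt).mono fun y hy _ => hy.le
    · -- By convexity the active half-space contains the whole epigraph of `R`.
      have hact : ∀ (y : E) (r : ℝ), R y ≤ r → inner ℝ (u i) (y - x) + s i * (r - rx) ≤ 0 := by
        intro y r hy
        have hline : Tendsto (fun τ : ℝ => x + τ • (y - x)) (𝓝[>] 0) (𝓝 x) := by
          have : Continuous fun τ : ℝ => x + τ • (y - x) := by fun_prop
          simpa using (this.tendsto 0).mono_left nhdsWithin_le_nhds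
        obtain ⟨τ, hτ, h0, h1⟩ :=
          ((hline.eventually hRP).and (Ioo_mem_nhdsGT (zero_lt_one (α := ℝ)))).exists
        have hseg := hR.le_segment hx.le hy h0.le h1.le
        rw [hτ] at hseg
        have h2 := (hP _ _).1 hseg i
        rw [inner_add_right, inner_smul_right] at h2
        by_contra! hpos
        nlinarith [mul_pos h0 hpos]
      have hs : s i ≤ 0 := by
        have := hact x (rx + 1) (by rw [hx]; exact_mod_cast (by linarith : rx ≤ rx + 1))
        simpa using this
      refine Eventually.of_forall fun y hy => ?_
      have key : inner ℝ (u i) (y - x) + s i * inner ℝ g (y - x) = 0 := by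
        rcases hs.lt_or_eq with hs | hs
        · have hv : (-(s i)⁻¹) • u i ∈ subdiff R x := by
            rw [mem_subdiff_iff hx]
            intro z r hz
            have h1 := hact z r hz
            rw [real_inner_smul_left]
            have h2 : 0 ≤ (-(s i)⁻¹) * -(inner ℝ (u i) (z - x) + s i * (r - rx)) :=
              mul_nonneg (by simpa using hs.le) (by linarith)
            have h3 : (s i)⁻¹ * (s i * (r - rx)) = r - rx := inv_mul_cancel_left₀ hs.ne _
            nlinarith
          have h1 := inner_eq_of_mem_tangent hg hv hy
          rw [← h1, real_inner_smul_left]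
          field_simp [hs.ne]
          ring
        · have hv : g + u i ∈ subdiff R x := by
            rw [mem_subdiff_iff hx]
            intro z r hz
            have h1 := hact z r hz
            have h2 := (mem_subdiff_iff hx).1 hg z r hz
            rw [hs, zero_mul, add_zero] at h1
            rw [inner_add_left]
            linarith
          have h1 := inner_eq_of_mem_tangent hg hv hy
          rw [inner_add_left] at h1
          rw [hs]; linarith
      have : inner ℝ (u i) y = inner ℝ (u i) x + inner ℝ (u i) (y - x) := by
        rw [← inner_add_right, add_sub_cancel]
      rw [this]; linarith
  filter_upwards [hRP, eventually_all.2 hall] with y hy1 hy2 hy3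
  rw [hy1, hP]
  exact fun i => hy2 i hy3

/-- A relative interior point of a set can be moved in every direction of the affine hull. -/
theorem exists_radius_of_mem_intrinsicInterior {S : Set E} {g : E}
    (hg : g ∈ intrinsicInterior ℝ S) :
    ∃ r : ℝ, 0 < r ∧ ∀ v ∈ vectorSpan ℝ S, ‖v‖ ≤ r → g + v ∈ S := by
  obtain ⟨y, hy, rfl⟩ := mem_intrinsicInterior.1 hg
  obtain ⟨ε, hε, hball⟩ := Metric.mem_nhds_iff.1 (mem_interior_iff_mem_nhds.1 hy)
  refine ⟨ε / 2, by positivity, fun v hv hvr => ?_⟩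
  have hmem : (y : E) + v ∈ affineSpan ℝ S := by
    rw [add_comm]
    exact AffineSubspace.vadd_mem_of_mem_direction (by rwa [direction_affineSpan]) y.2
  refine hball (show (⟨(y : E) + v, hmem⟩ : affineSpan ℝ S) ∈ Metric.ball y ε from ?_)
  rw [Metric.mem_ball, Subtype.dist_eq, dist_eq_norm]
  simp only [add_sub_cancel_left]
  linarith

/-- Finite identification: a point near `x` with a subgradient close to the relatively interior
subgradient `g` lies on `x + T`, since off `x + T` the function grows by at least `r` times the
distance to `x + T` more than its affine part. -/
theorem sub_mem_tangent_of_subgradient_near [FiniteDimensional ℝ E] {R : E → EReal}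
    (hR : IsGammaZero R) {x g p w : E}
    {rx r : ℝ} (hx : R x = rx) (hr : 0 < r)
    (hsharp : ∀ v ∈ vectorSpan ℝ (subdiff R x), ‖v‖ ≤ r → g + v ∈ subdiff R x)
    (hq : R (x + (tangent R x).starProjection (p - x)) ≤
      ((rx + inner ℝ g ((tangent R x).starProjection (p - x)) : ℝ) : EReal))
    (hw : w ∈ subdiff R p) (hwg : ‖w - g‖ < r) : p - x ∈ tangent R x := by
  obtain ⟨rp, hrp⟩ := hR.exists_coe_of_mem_subdiff hw
  set T := tangent R x with hT
  set z := T.starProjection (p - x) with hz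
  set e := (p - x) - z with he
  have heT : e ∈ Tᗮ := Submodule.sub_starProjection_mem_orthogonal _
  have hzT : z ∈ T := Submodule.starProjection_apply_mem _ _
  have heV : e ∈ vectorSpan ℝ (subdiff R x) := by
    have : Tᗮ = vectorSpan ℝ (subdiff R x) := Submodule.orthogonal_orthogonal _
    rwa [this] at heT
  by_cases he0 : e = 0
  · have : p - x = z := sub_eq_zero.1 he0
    rw [this]; exact hzT
  exfalso
  have hepos : 0 < ‖e‖ := norm_pos_iff.2 he0
  have hpx : p - x = e + z := by rw [he]; abel
  have hinner : inner ℝ e (p - x) = ‖e‖ ^ 2 := by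
    rw [hpx, inner_add_right, Submodule.inner_left_of_mem_orthogonal hzT heT, add_zero,
      real_inner_self_eq_norm_sq]
  have h1 := (mem_subdiff_iff hx).1
    (hsharp ((r / ‖e‖) • e) (Submodule.smul_mem _ _ heV) (by
      rw [norm_smul, Real.norm_of_nonneg (by positivity), div_mul_cancel₀ _ hepos.ne'])) p rp hrp.le
  rw [inner_add_left, real_inner_smul_left, hinner] at h1
  have h2 : r / ‖e‖ * ‖e‖ ^ 2 = r * ‖e‖ := by field_simp
  have h3 := (mem_subdiff_iff hrp).1 hw _ _ hq
  have h4 : x + z - p = -e := by rw [he]; abel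
  rw [h4, inner_neg_right] at h3
  rw [h2, hpx, inner_add_right] at h1
  have h5 : inner ℝ (w - g) e ≤ ‖w - g‖ * ‖e‖ := real_inner_le_norm _ _
  rw [inner_sub_left] at h5
  nlinarith

theorem inner_eq_of_mem_subdiff_near {R : E → EReal} (hR : IsGammaZero R) {x g p w d : E}
    {rx : ℝ} (hx : R x = rx) (hg : g ∈ subdiff R x) (hw : w ∈ subdiff R p)
    (hp : p - x ∈ tangent R x)
    (hloc : ∀ᶠ y in 𝓝 p, y - x ∈ tangent R x → R y ≤ ((rx + inner ℝ g (y - x) : ℝ) : EReal))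
    (hd : d ∈ tangent R x) : inner ℝ w d = inner ℝ g d := by
  suffices H : ∀ d ∈ tangent R x, inner ℝ w d ≤ inner ℝ g d by
    refine (H d hd).antisymm ?_
    have := H (-d) (neg_mem hd)
    rw [inner_neg_right, inner_neg_right] at this
    linarith
  intro d hd
  obtain ⟨rp, hrp⟩ := hR.exists_coe_of_mem_subdiff hw
  have hline : Tendsto (fun τ : ℝ => p + τ • d) (𝓝[>] 0) (𝓝 p) := by
    have : Continuous fun τ : ℝ => p + τ • d := by fun_prop
    simpa using (this.tendsto 0).mono_left nhdsWithin_le_nhds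
  obtain ⟨τ, hτ, h0⟩ := ((hline.eventually hloc).and self_mem_nhdsWithin).exists
  have h0 : 0 < τ := h0
  have hsub : p + τ • d - x = (p - x) + τ • d := by abel
  rw [hsub] at hτ
  have h1 := (mem_subdiff_iff hrp).1 hw _ _ (hτ (add_mem hp (Submodule.smul_mem _ _ hd)))
  have h2 := (mem_subdiff_iff hx).1 hg p rp hrp.le
  rw [add_sub_cancel_left, inner_smul_right, inner_add_right, inner_smul_right] at h1
  nlinarith

end Convex

/-! ### The Hessian and the linearized step -/

section Hessian

variable {E : Type*} [NormedAddCommGroup E] [InnerProductSpace ℝ E]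

theorem eq_zero_of_inner_self_nonpos {Q : E →L[ℝ] E}
    (hsymm : ∀ v w, inner ℝ (Q v) w = inner ℝ v (Q w))
    (hpos : ∀ v, 0 ≤ inner ℝ (Q v) v) {v : E} (hv : inner ℝ (Q v) v ≤ 0) : Q v = 0 := by
  have hv0 := le_antisymm hv (hpos v)
  have h : 0 ≤ -2 * ‖Q v‖ ^ 2 := by
    refine nonneg_of_forall_add_mul_nonneg (B := inner ℝ (Q (Q v)) (Q v)) fun t ht _ => ?_
    have h1 := hpos (v - t • Q v)
    simp only [map_sub, map_smul, inner_sub_left, inner_sub_right, real_inner_smul_left,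
      real_inner_smul_right, hv0, hsymm (Q v) v, real_inner_self_eq_norm_sq] at h1
    refine nonneg_of_mul_nonneg_right (a := t) ?_ ht
    nlinarith
  have : ‖Q v‖ ^ 2 ≤ 0 := by linarith
  exact norm_eq_zero.1 (by nlinarith [norm_nonneg (Q v)])

variable [CompleteSpace E]

/-- The inverse Riesz isomorphism as a real-linear map, so that `∇F` is the composition of a
continuous linear map with `fderiv ℝ F`. -/
noncomputable def rieszInv : (E →L[ℝ] ℝ) →L[ℝ] E :=
  LinearMap.mkContinuous
    { toFun := fun φ => (InnerProductSpace.toDual ℝ E).symm φ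
      map_add' := fun φ ψ => map_add _ φ ψ
      map_smul' := fun c φ => by simp } 1 (fun φ => by simp)

theorem inner_rieszInv (φ : E →L[ℝ] ℝ) (w : E) : inner ℝ (rieszInv φ) w = φ w :=
  InnerProductSpace.toDual_symm_apply

theorem gradient_eq_rieszInv (F : E → ℝ) : gradient F = fun y => rieszInv (fderiv ℝ F y) := rfl

theorem contDiffAt_gradient {F : E → ℝ} {x : E} (h : ContDiffAt ℝ 2 F x) :
    ContDiffAt ℝ 1 (gradient F) x := by
  rw [gradient_eq_rieszInv]
  exact (rieszInv (E := E)).contDiff.contDiffAt.comp x (h.fderiv_right (m := 1) (by norm_num))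

theorem hasFDerivAt_gradient {F : E → ℝ} {x : E} (h : ContDiffAt ℝ 2 F x) :
    HasFDerivAt (gradient F) (hessian F x) x :=
  ((contDiffAt_gradient h).differentiableAt one_ne_zero).hasFDerivAt

theorem inner_hessian {F : E → ℝ} {x : E} (h : ContDiffAt ℝ 2 F x) (v w : E) :
    inner ℝ (hessian F x v) w = fderiv ℝ (fderiv ℝ F) x v w := by
  have h1 : DifferentiableAt ℝ (fderiv ℝ F) x :=
    (h.fderiv_right (m := 1) (by norm_num)).differentiableAt one_ne_zero
  have h2 : hessian F x = (rieszInv (E := E)).comp (fderiv ℝ (fderiv ℝ F) x) :=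
    ((rieszInv (E := E)).hasFDerivAt.comp x h1.hasFDerivAt).fderiv
  rw [h2, ContinuousLinearMap.comp_apply, inner_rieszInv]

theorem inner_hessian_comm {F : E → ℝ} {x : E} (h : ContDiffAt ℝ 2 F x) (v w : E) :
    inner ℝ (hessian F x v) w = inner ℝ v (hessian F x w) := by
  rw [real_inner_comm, real_inner_comm (hessian F x w), inner_hessian h, real_inner_comm,
    inner_hessian h]
  exact (h.isSymmSndFDerivAt (by simp)).eq v w

theorem inner_hessian_self_nonneg {F : E → ℝ} {x : E} (h : ContDiffAt ℝ 2 F x)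
    (hconv : ConvexOn ℝ univ F) (hdiff : Differentiable ℝ F) (v : E) :
    0 ≤ inner ℝ (hessian F x v) v := by
  -- `τ ↦ ⟨∇F(x + τ v), v⟩` is the derivative of a convex function, hence monotone.
  have hline : ∀ τ : ℝ, HasDerivAt (fun τ : ℝ => x + τ • v) v τ := fun τ => by
    simpa using ((hasDerivAt_id τ).smul_const v).const_add x
  have hφ : ∀ τ : ℝ, HasDerivAt (fun τ : ℝ => F (x + τ • v))
      (inner ℝ (gradient F (x + τ • v)) v) τ :=
    fun τ => by
      rw [inner_gradient_left]
      exact (hdiff _).hasFDerivAt.comp_hasDerivAt τ (hline τ)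
  have hcomp : ConvexOn ℝ univ (fun τ : ℝ => F (x + τ • v)) := by
    have := hconv.comp_affineMap (AffineMap.lineMap x (x + v) : ℝ →ᵃ[ℝ] E)
    rw [preimage_univ] at this
    have heq : (fun τ : ℝ => F (x + τ • v)) = F ∘ (AffineMap.lineMap x (x + v) : ℝ →ᵃ[ℝ] E) := by
      funext τ
      simp [AffineMap.lineMap_apply, add_comm]
    rwa [heq]
  have hmono : Monotone fun τ : ℝ => inner ℝ (gradient F (x + τ • v)) v := by
    have := hcomp.monotoneOn_deriv fun τ _ => (hφ τ).differentiableAt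
    rw [monotoneOn_univ] at this
    convert this using 2 with τ
    exact (hφ τ).deriv.symm
  have hder : HasDerivAt (fun τ : ℝ => inner ℝ (gradient F (x + τ • v)) v)
      (inner ℝ (hessian F x v) v) 0 := by
    have h1 : HasFDerivAt (gradient F) (hessian F x) (x + (0 : ℝ) • v) := by
      simpa using hasFDerivAt_gradient h
    have h2 := h1.comp_hasDerivAt 0 (hline 0)
    simpa using h2.inner ℝ (hasDerivAt_const (0 : ℝ) v)
  rw [← hder.deriv]
  exact hmono.deriv_nonneg

/-- The first-order expansion of the gradient at a point where the Hessian is Hölder continuous. -/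
theorem eventually_gradient_remainder_le {F : E → ℝ} {x : E} (h : ContDiffAt ℝ 2 F x) {α L : ℝ}
    (hα : 0 < α) (hL : 0 ≤ L)
    (hH : ∀ᶠ y in 𝓝 x, ‖hessian F y - hessian F x‖ ≤ L * ‖y - x‖ ^ α) :
    ∀ᶠ y in 𝓝 x, ‖gradient F y - gradient F x - hessian F x (y - x)‖ ≤
      L * ‖y - x‖ ^ α * ‖y - x‖ := by
  have hdiff : ∀ᶠ y in 𝓝 x, DifferentiableAt ℝ (gradient F) y :=
    (h.eventually (by simp)).mono fun y hy => (hasFDerivAt_gradient hy).differentiableAt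
  obtain ⟨ε, hε, hball⟩ := Metric.eventually_nhds_iff_ball.1 (hH.and hdiff)
  filter_upwards [Metric.ball_mem_nhds x hε] with y hy
  have hsub : ∀ z ∈ Metric.closedBall x ‖y - x‖, z ∈ Metric.ball x ε := fun z hz => by
    rw [Metric.mem_ball, dist_eq_norm] at hy
    exact (Metric.mem_closedBall.1 hz).trans_lt hy
  refine Convex.norm_image_sub_le_of_norm_fderiv_le' (𝕜 := ℝ) (s := Metric.closedBall x ‖y - x‖)
    (fun z hz => (hball z (hsub z hz)).2) (fun z hz => ?_) (convex_closedBall _ _)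
    (Metric.mem_closedBall_self (norm_nonneg _)) (by rw [Metric.mem_closedBall, dist_eq_norm])
  refine ((hball z (hsub z hz)).1).trans ?_
  rw [Metric.mem_closedBall, dist_eq_norm] at hz
  gcongr

end Hessian

section Operators

variable {E : Type*} [NormedAddCommGroup E] [InnerProductSpace ℝ E] [FiniteDimensional ℝ E]

theorem opG_apply (T : Submodule ℝ E) (Q : E →L[ℝ] E) (γ : ℝ) (v : T) :
    opG T Q γ v = v - γ • T.orthogonalProjectionOnto (Q v) := rfl

theorem inner_opG (T : Submodule ℝ E) (Q : E →L[ℝ] E) (γ : ℝ) (v w : T) :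
    inner ℝ (opG T Q γ v) w = inner ℝ (v : E) w - γ * inner ℝ (Q v) (w : E) := by
  rw [opG_apply, inner_sub_left, real_inner_smul_left,
    Submodule.inner_orthogonalProjectionOnto_eq_of_mem_right, Submodule.coe_inner]

theorem isSymmetric_opG (T : Submodule ℝ E) {Q : E →L[ℝ] E}
    (hsymm : ∀ v w, inner ℝ (Q v) w = inner ℝ v (Q w)) (γ : ℝ) :
    LinearMap.IsSymmetric (opG T Q γ) := by
  intro v w
  rw [inner_opG, real_inner_comm (opG T Q γ w) v, inner_opG, hsymm (v : E) w,
    real_inner_comm (w : E) v, real_inner_comm (Q w) (v : E)]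

theorem eigenvalue_opG_lt_one {T : Submodule ℝ E} {Q : E →L[ℝ] E}
    (hsymm : ∀ v w, inner ℝ (Q v) w = inner ℝ v (Q w)) (hpos : ∀ v, 0 ≤ inner ℝ (Q v) v)
    (hRI : Q.toLinearMap.ker ⊓ T = ⊥) {γ : ℝ} (hγ : 0 < γ) {η : ℝ}
    (hη : (opG T Q γ).HasEigenvalue η) : η < 1 := by
  obtain ⟨v, hv⟩ := hη.exists_hasEigenvector
  by_contra! hge
  have h1 := inner_opG T Q γ v v
  rw [hv.apply_eq_smul, real_inner_smul_left, ← Submodule.coe_inner, real_inner_self_eq_norm_sq]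
    at h1
  have h2 : inner ℝ (Q v) (v : E) ≤ 0 := by
    by_contra! h
    nlinarith [mul_pos hγ h, mul_nonneg (sub_nonneg.2 hge) (sq_nonneg ‖v‖)]
  have h3 : (v : E) ∈ Q.toLinearMap.ker ⊓ T := ⟨eq_zero_of_inner_self_nonpos hsymm hpos h2, v.2⟩
  rw [hRI, Submodule.mem_bot] at h3
  exact hv.2 (by simpa using h3)

/-- The deviation of one step of the inertial iteration on `T` from the limiting block operator. -/
theorem norm_step_sub_opM_le {T : Submodule ℝ E} {Q : E →L[ℝ] E} {a b γ a' b' γ' : ℝ}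
    (hb' : b' ∈ Icc (0 : ℝ) 1) {r₀ r₁ r₂ : T} {e : E}
    (h : r₂ = r₁ + a' • (r₁ - r₀) -
      γ' • T.orthogonalProjectionOnto (Q (r₁ + b' • (r₁ - r₀) : T) + e)) :
    ‖((r₂, r₁) : T × T) - opM (opG T Q γ) a b (r₁, r₀)‖ ≤
      (2 * |a' - a| + 3 * ‖Q‖ * |γ' - γ| + 2 * ‖Q‖ * |γ| * |b' - b|) * ‖((r₁, r₀) : T × T)‖
        + |γ'| * ‖e‖ := by
  set P := T.orthogonalProjectionOnto with hP
  set D := ‖((r₁, r₀) : T × T)‖ with hD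
  have h1 : ‖r₁‖ ≤ D := norm_fst_le ((r₁, r₀) : T × T)
  have h0 : ‖r₀‖ ≤ D := norm_snd_le ((r₁, r₀) : T × T)
  have hsub : ‖r₁ - r₀‖ ≤ 2 * D := (norm_sub_le _ _).trans (by linarith)
  have hs : ‖r₁ + b' • (r₁ - r₀)‖ ≤ 3 * D := by
    refine (norm_add_le _ _).trans ?_
    rw [norm_smul, Real.norm_of_nonneg hb'.1]
    nlinarith [hb'.2, norm_nonneg (r₁ - r₀)]
  have hPQ : ∀ v : T, ‖P (Q v)‖ ≤ ‖Q‖ * ‖v‖ := fun v =>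
    (T.norm_orthogonalProjectionOnto_apply_le _).trans (Q.le_opNorm _)
  have hPe : ‖P e‖ ≤ ‖e‖ := T.norm_orthogonalProjectionOnto_apply_le _
  have hdiff : ((r₂, r₁) : T × T) - opM (opG T Q γ) a b (r₁, r₀) =
      ((a' - a) • (r₁ - r₀) - (γ' - γ) • P (Q (r₁ + b' • (r₁ - r₀) : T))
        - (γ * (b' - b)) • P (Q (r₁ - r₀ : T)) - γ' • P e, 0) := by
    rw [opM_apply, Prod.mk_sub_mk, sub_self, h]
    simp only [opG_apply, ← hP, map_add, map_sub, map_smul, Submodule.coe_add, Submodule.coe_sub,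
      Submodule.coe_smul]
    congr 1
    module
  rw [hdiff, Prod.norm_mk, norm_zero, max_eq_left (norm_nonneg _)]
  have hQ := norm_nonneg Q
  calc _ ≤ |a' - a| * (2 * D) + |γ' - γ| * (‖Q‖ * (3 * D)) + |γ * (b' - b)| * (‖Q‖ * (2 * D))
        + |γ'| * ‖e‖ := by
        refine (norm_sub_le _ _).trans (add_le_add ((norm_sub_le _ _).trans (add_le_add
          ((norm_sub_le _ _).trans (add_le_add ?_ ?_)) ?_)) ?_) <;> rw [norm_smul, Real.norm_eq_abs]
        · gcongr
        · gcongr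
          exact (hPQ _).trans (by gcongr)
        · gcongr
          exact (hPQ _).trans (by gcongr)
        · gcongr
    _ = _ := by rw [abs_mul]; ring

end Operators

/-! ### The iteration near the solution -/

section Iteration

variable {E : Type*} [NormedAddCommGroup E] [InnerProductSpace ℝ E]

theorem tendsto_extrap {x : ℕ → E} {z : E} (hx : Tendsto x atTop (𝓝 z)) {c : ℕ → ℝ}
    (hc : ∀ k, c k ∈ Icc (0 : ℝ) 1) : Tendsto (fun k => extrap x (c k) k) atTop (𝓝 z) := by
  have hx' : Tendsto (fun k => x (k - 1)) atTop (𝓝 z) := hx.comp (tendsto_sub_atTop_nat 1)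
  have h1 : Tendsto (fun k => c k • (x k - x (k - 1))) atTop (𝓝 0) := by
    have h2 : Tendsto (fun k => ‖x k - x (k - 1)‖) atTop (𝓝 0) := by
      simpa using (hx.sub hx').norm
    refine squeeze_zero_norm (fun k => ?_) h2
    rw [norm_smul, Real.norm_of_nonneg (hc k).1]
    exact mul_le_of_le_one_left (norm_nonneg _) (hc k).2
  simpa [extrap] using hx.add h1

/-- `LinearRate` bounds the errors by the single error at the starting index; the passage from the
two-step state is a matter of choosing that index. -/
theorem linearRate_of_norm_le {E V : Type*} [NormedAddCommGroup E] [NormedAddCommGroup V]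
    {x : ℕ → E} {z : E} {ρ : ℝ}
    (hρ : 0 ≤ ρ) {d : ℕ → V} (hxd : ∀ᶠ k in atTop, ‖x k - z‖ ≤ ‖d k‖) {C : ℝ} (hC : 0 < C)
    (h : ∀ᶠ K in atTop, ∀ k, K ≤ k → ‖d k‖ ≤ C * ρ ^ (k - K) * ‖d K‖) : LinearRate x z ρ := by
  by_cases hz : ∃ᶠ K in atTop, x K ≠ z
  · -- Start at an index with `x K ≠ z`, so that `‖d K‖` is a multiple of `‖x K - z‖`.
    obtain ⟨K₀, hK₀⟩ := eventually_atTop.1 hxd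
    obtain ⟨K, hK, hrate, hK0, hK1⟩ :=
      (hz.and_eventually (h.and ((eventually_ge_atTop K₀).and (eventually_gt_atTop 0)))).exists
    have hpos : 0 < ‖x K - z‖ := norm_pos_iff.2 (sub_ne_zero.2 hK)
    have hdpos : 0 < ‖d K‖ := hpos.trans_le (hK₀ K hK0)
    refine ⟨K, hK1, C * ‖d K‖ / ‖x K - z‖, by positivity, fun k hk => ?_⟩
    calc ‖x k - z‖ ≤ C * ρ ^ (k - K) * ‖d K‖ := (hK₀ k (hK0.trans hk)).trans (hrate k hk)
      _ = _ := by field_simp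
  · obtain ⟨K, hK⟩ := eventually_atTop.1 (not_frequently.1 hz)
    refine ⟨K + 1, K.succ_pos, 1, one_pos, fun k hk => ?_⟩
    have : x k = z := not_not.1 (hK k (by omega))
    rw [this, sub_self, norm_zero]
    positivity

variable [FiniteDimensional ℝ E]

/-- From some index on the iterates lie on `x* + T`, where the proximal step reduces to the
projection of an explicit gradient step: all subgradients of `R` at points of `x* + T` near `x*`
have the same component along `T`. -/
theorem IsFBSequence.eventually_recursion {F : E → ℝ} {R : E → EReal} {β : ℝ}
    (hR : IsGammaZero R) (hF : IsSmoothConvex F β) {a b γ : ℕ → ℝ} {x : ℕ → E}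
    (hx : IsFBSequence F R β a b γ x) {z : E} (hconv : Tendsto x atTop (𝓝 z))
    (hpoly : IsLocallyPolyhedral R z) (hND : -gradient F z ∈ intrinsicInterior ℝ (subdiff R z)) :
    ∀ᶠ k in atTop, x (k + 1) - z ∈ tangent R z ∧
      (tangent R z).orthogonalProjectionOnto (x (k + 1) - z) =
        (tangent R z).orthogonalProjectionOnto (extrap x (a k) k - z
          - γ k • (gradient F (extrap x (b k) k) - gradient F z)) := by
  obtain ⟨ε₁, ε₂, hε₁, -, hstep⟩ := hx.step_mem
  have hγ : ∀ k, 0 < γ k := fun k => hε₁.trans_le (hstep k).1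
  have hg := intrinsicInterior_subset hND
  obtain ⟨rz, hrz⟩ := hR.exists_coe_of_mem_subdiff hg
  obtain ⟨r, hr, hsharp⟩ := exists_radius_of_mem_intrinsicInterior hND
  have hloc := hpoly.eventually_le hR hg hrz
  set T := tangent R z with hT
  let w : ℕ → E := fun k => (γ k)⁻¹ • ((extrap x (a k) k - γ k • gradient F (extrap x (b k) k))
    - x (k + 1))
  have hw : ∀ k, w k ∈ subdiff R (x (k + 1)) := fun k =>
    (hx.iterate k).smul_sub_mem_subdiff hR (hγ k)
  have hw' : ∀ k, w k - -gradient F z = (γ k)⁻¹ • (extrap x (a k) k - x (k + 1))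
      - (gradient F (extrap x (b k) k) - gradient F z) := fun k => by
    simp only [w, smul_sub, inv_smul_smul₀ (hγ k).ne']
    abel
  have hconv1 : Tendsto (fun k => x (k + 1)) atTop (𝓝 z) := hconv.comp (tendsto_add_atTop_nat 1)
  have hwlim : Tendsto (fun k => ‖w k - -gradient F z‖) atTop (𝓝 0) := by
    have h1 : Tendsto (fun k => ε₁⁻¹ * ‖extrap x (a k) k - x (k + 1)‖
        + 1 / β * ‖extrap x (b k) k - z‖) atTop (𝓝 (ε₁⁻¹ * ‖z - z‖ + 1 / β * ‖z - z‖)) :=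
      (((tendsto_extrap hconv hx.a_mem).sub hconv1).norm.const_mul _).add
        (((tendsto_extrap hconv hx.b_mem).sub tendsto_const_nhds).norm.const_mul _)
    simp only [sub_self, norm_zero, mul_zero, add_zero] at h1
    refine squeeze_zero (fun _ => norm_nonneg _) (fun k => ?_) h1
    rw [hw' k]
    refine (norm_sub_le _ _).trans (add_le_add ?_ (hF.lipschitz _ _))
    rw [norm_smul, Real.norm_of_nonneg (inv_nonneg.2 (hγ k).le)]
    have := (hstep k).1
    gcongr
  have hproj : Tendsto (fun p => z + T.starProjection (p - z)) (𝓝 z) (𝓝 z) := by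
    have : Continuous fun p => z + T.starProjection (p - z) := by fun_prop
    simpa using this.tendsto z
  filter_upwards [hwlim.eventually_lt_const hr, hconv1.eventually hloc.eventually_nhds,
    (hproj.comp hconv1).eventually hloc] with k hk1 hk2 hk3
  simp only [Function.comp_apply, add_sub_cancel_left] at hk3
  have hmem : x (k + 1) - z ∈ T :=
    sub_mem_tangent_of_subgradient_near hR hrz hr hsharp
      (hk3 (Submodule.starProjection_apply_mem _ _)) (hw k) hk1
  refine ⟨hmem, ?_⟩
  have h0 : T.orthogonalProjectionOnto (w k - -gradient F z) = 0 := by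
    rw [Submodule.orthogonalProjectionOnto_eq_zero_iff, Submodule.mem_orthogonal']
    intro d hd
    rw [inner_sub_left, inner_eq_of_mem_subdiff_near hR hrz hg (hw k) hmem hk2 hd, sub_self]
  rw [eq_comm, ← sub_eq_zero, ← map_sub]
  have h1 : extrap x (a k) k - z - γ k • (gradient F (extrap x (b k) k) - gradient F z)
      - (x (k + 1) - z) = γ k • (w k - -gradient F z) := by
    rw [hw' k, smul_sub (γ k) ((γ k)⁻¹ • _), smul_inv_smul₀ (hγ k).ne']
    abel
  rw [h1, map_smul, h0, smul_zero]

/-- The local rates of a sequence that lies on `z + T` eventually and follows there the projected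
inertial gradient recursion: two consecutive errors form a state `d` with
`d (k + 1) = M d k + o(d k)`, and for constant parameters and a Hölder continuous Hessian the
perturbation is `O(‖d k‖ ^ (1 + α))`. -/
theorem rates_of_eventually_recursion {F : E → ℝ} {β : ℝ} (hF : IsSmoothConvex F β)
    {ak bk γk : ℕ → ℝ} {x : ℕ → E} (haI : ∀ k, ak k ∈ Icc (0 : ℝ) 1)
    (hbI : ∀ k, bk k ∈ Icc (0 : ℝ) 1) {z : E} (hconv : Tendsto x atTop (𝓝 z))
    (hC2 : ContDiffAt ℝ 2 F z) {T : Submodule ℝ E}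
    (hrec : ∀ᶠ k in atTop, x (k + 1) - z ∈ T ∧
      T.orthogonalProjectionOnto (x (k + 1) - z) =
        T.orthogonalProjectionOnto (extrap x (ak k) k - z
          - γk k • (gradient F (extrap x (bk k) k) - gradient F z)))
    (hRI : (hessian F z).toLinearMap.ker ⊓ T = ⊥)
    {a b γ : ℝ} (ha : Tendsto ak atTop (𝓝 a)) (hb : Tendsto bk atTop (𝓝 b))
    (hγ : Tendsto γk atTop (𝓝 γ)) (hγ0 : 0 < γ) (hab : ¬(a = 1 ∧ b = 0))
    {G : Module.End ℝ T} (hG : G = opG T (hessian F z) γ)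
    (hspec : ∀ η : ℝ, G.HasEigenvalue η → (2 * (b - a) - 1) / (1 + 2 * b) < η)
    {M : Module.End ℝ (T × T)} (hM : M = opM G a b) :
    rho M < 1 ∧ (∀ ρ : ℝ, rho M < ρ → ρ < 1 → LinearRate x z ρ) ∧
    ((∀ k, ak k = a) → (∀ k, bk k = b) → (∀ k, γk k = γ) →
      (∃ α : ℝ, 0 < α ∧ ∃ L : ℝ, ∀ᶠ y in 𝓝 z,
        ‖hessian F y - hessian F z‖ ≤ L * ‖y - z‖ ^ α) →
      PeripherallySemisimple M → LinearRate x z (rho M)) := by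
  set Q := hessian F z with hQ
  have hsymm := inner_hessian_comm hC2
  have hpos := inner_hessian_self_nonneg hC2 hF.convex hF.differentiable
  have hrho : rho M < 1 := by
    rw [hM]
    refine rho_opM_lt_one (hG ▸ isSymmetric_opG T hsymm γ)
      (isClosed_Icc.mem_of_tendsto ha (Eventually.of_forall haI))
      (isClosed_Icc.mem_of_tendsto hb (Eventually.of_forall hbI)) hab (fun η hη => ?_) hspec
    rw [hG] at hη
    exact eigenvalue_opG_lt_one hsymm hpos hRI hγ0 hη
  -- The state `d k` collects two consecutive errors, the defect `e k` is the remainder of the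
  -- linearization of the gradient.
  let r : ℕ → T := fun k => T.orthogonalProjectionOnto (x k - z)
  let d : ℕ → T × T := fun k => (r k, r (k - 1))
  let y : ℕ → E := fun k => extrap x (bk k) k
  let e : ℕ → E := fun k =>
    gradient F (y k) - gradient F z - Q (y k - z)
  have hmem : ∀ᶠ k in atTop, x k - z ∈ T := by
    obtain ⟨K, hK⟩ := eventually_atTop.1 hrec
    filter_upwards [eventually_ge_atTop (K + 1)] with k hk
    obtain ⟨j, rfl⟩ : ∃ j, k = j + 1 := ⟨k - 1, by omega⟩
    exact (hK j (by omega)).1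
  have hmem' : ∀ᶠ k in atTop, x (k - 1) - z ∈ T := (tendsto_sub_atTop_nat 1).eventually hmem
  have hcoe : ∀ {u : E}, u ∈ T → (T.orthogonalProjectionOnto u : _) = u :=
    fun hu => congrArg Subtype.val (T.orthogonalProjectionOnto_mem_subspace_eq_self ⟨_, hu⟩)
  have hyr : ∀ᶠ k in atTop, y k - z = (r k + bk k • (r k - r (k - 1)) : T) := by
    filter_upwards [hmem, hmem'] with k h1 h2
    simp only [r, y, extrap, Submodule.coe_add, Submodule.coe_smul, Submodule.coe_sub, hcoe h1,
      hcoe h2]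
    module
  have hyd : ∀ᶠ k in atTop, ‖y k - z‖ ≤ 3 * ‖d k‖ := by
    filter_upwards [hyr] with k hk
    have h1 : ‖r k‖ ≤ ‖d k‖ := norm_fst_le (d k)
    have h0 : ‖r (k - 1)‖ ≤ ‖d k‖ := norm_snd_le (d k)
    have hbk := hbI k
    rw [hk, ← Submodule.coe_norm]
    refine (norm_add_le _ _).trans ?_
    rw [norm_smul, Real.norm_of_nonneg hbk.1]
    nlinarith [norm_sub_le (r k) (r (k - 1)), norm_nonneg (r k - r (k - 1)), hbk.2]
  have hstep : ∀ᶠ k in atTop, ‖d (k + 1) - M (d k)‖ ≤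
      (2 * |ak k - a| + 3 * ‖Q‖ * |γk k - γ| + 2 * ‖Q‖ * |γ| * |bk k - b|) * ‖d k‖
        + |γk k| * ‖e k‖ := by
    filter_upwards [hrec, hyr] with k h1 h2
    rw [hM, hG]
    refine norm_step_sub_opM_le (r₀ := r (k - 1)) (r₁ := r k) (hbI k) ?_
    have h3 : Q (r k + bk k • (r k - r (k - 1)) : T) + e k =
        gradient F (y k) - gradient F z := by
      rw [← h2]; simp only [e]; abel
    rw [h3]
    have h4 : extrap x (ak k) k - z = (x k - z) +
        ak k • ((x k - z) - (x (k - 1) - z)) := by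
      simp only [extrap]; module
    simp only [r]
    rw [h1.2, h4]
    simp only [map_add, map_sub, map_smul, y]
  have hylim : Tendsto y atTop (𝓝 z) := tendsto_extrap hconv hbI
  have hxd : ∀ᶠ k in atTop, ‖x k - z‖ ≤ ‖d k‖ := by
    filter_upwards [hmem] with k hk
    have h1 : ‖r k‖ ≤ ‖d k‖ := norm_fst_le (d k)
    rwa [Submodule.coe_norm, hcoe hk] at h1
  have hlin : (fun k => d (k + 1) - M (d k)) =o[atTop] d := by
    have hyO : (fun k => y k - z) =O[atTop] d := Asymptotics.IsBigO.of_bound 3 hyd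
    have he : e =o[atTop] d :=
      (((hasFDerivAt_gradient hC2).isLittleO).comp_tendsto hylim).trans_isBigO hyO
    have hγO : (fun k => |γk k|) =O[atTop] (fun _ => (1 : ℝ)) := hγ.abs.isBigO_one ℝ
    have hsmall : Tendsto (fun k => 2 * |ak k - a| + 3 * ‖Q‖ * |γk k - γ|
        + 2 * ‖Q‖ * |γ| * |bk k - b|) atTop (𝓝 0) := by
      have h1 := (((ha.sub_const a).abs.const_mul 2).add
        ((hγ.sub_const γ).abs.const_mul (3 * ‖Q‖))).add
        ((hb.sub_const b).abs.const_mul (2 * ‖Q‖ * |γ|))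
      simpa using h1
    have h1 : (fun k => (2 * |ak k - a| + 3 * ‖Q‖ * |γk k - γ|
        + 2 * ‖Q‖ * |γ| * |bk k - b|) * ‖d k‖) =o[atTop] d := by
      have := ((Asymptotics.isLittleO_one_iff ℝ).2 hsmall).mul_isBigO
        (Asymptotics.isBigO_refl (fun k => ‖d k‖) atTop)
      simpa using this.norm_right
    have h2 : (fun k => |γk k| * ‖e k‖) =o[atTop] d := by
      have := hγO.mul_isLittleO he.norm_norm
      simpa using this.norm_right
    refine Asymptotics.IsBigO.trans_isLittleO ?_ (h1.add h2)
    exact Asymptotics.IsBigO.of_bound' (hstep.mono fun k hk => hk.trans (le_abs_self _))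
  have hrate : ∀ ρ, rho M < ρ → ∃ C : ℝ, 0 < C ∧ ∀ᶠ K in atTop, ∀ k, K ≤ k →
      ‖d k‖ ≤ C * ρ ^ (k - K) * ‖d K‖ := fun ρ hρ => exists_rate_of_rho_lt hρ hlin
  refine ⟨hrho, fun ρ hρ _ => ?_, ?_⟩
  · obtain ⟨C, hC, h⟩ := hrate ρ hρ
    exact linearRate_of_norm_le ((rho_nonneg M).trans hρ.le) hxd hC h
  · rintro hak hbk hγk ⟨α, hα, L, hL⟩ hss
    obtain ⟨C, hC0, hC⟩ := exists_pow_bound (M := M) (rho_nonneg M) fun σ hσ =>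
      (norm_le_rho hσ).lt_or_eq.imp_right fun h => ⟨h, hss σ h⟩
    rcases (rho_nonneg M).eq_or_lt with h0 | h0
    · -- If `ρ(M) = 0`, semisimplicity gives `M = 0`, which forces `T = 0` because of the identity block of `M`.
      have hM0 : ∀ w, M w = 0 := fun w => by
        have := hC 1 w
        rw [← h0] at this
        simpa using this
      have hx0 : ∀ᶠ k in atTop, ‖x k - z‖ ≤ ‖(0 : T)‖ := by
        filter_upwards [hmem] with k hk
        have h1 := congrArg Prod.snd (hM0 (⟨x k - z, hk⟩, 0))
        rw [hM, opM_apply] at h1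
        have h2 : x k - z = 0 := congrArg Subtype.val h1
        rw [h2]; simp
      exact linearRate_of_norm_le (d := fun _ => (0 : T)) (rho_nonneg M) hx0 one_pos
        (Eventually.of_forall fun K k _ => by simp)
    · -- The a priori rate `q < 1` makes the relative errors, of size `‖d k‖ ^ α`, summable.
      obtain ⟨q, hq1, hq2⟩ := exists_between hrho
      have hq0 : 0 < q := h0.trans hq1
      obtain ⟨C₁, hC₁, h⟩ := hrate q hq1
      obtain ⟨K, hK⟩ := h.exists
      set L' := max L 0
      have hL' : 0 ≤ L' := le_max_right _ _
      have hHol : ∀ᶠ y in 𝓝 z, ‖hessian F y - hessian F z‖ ≤ L' * ‖y - z‖ ^ α :=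
        hL.mono fun y hy => hy.trans (by gcongr; exact le_max_left _ _)
      have hrem := hylim.eventually (eventually_gradient_remainder_le hC2 hα hL' hHol)
      have hsum : Summable fun k => γ * L' * 3 * (3 * ‖d k‖) ^ α := by
        apply Summable.mul_left
        rw [← summable_nat_add_iff K]
        have hqα : q ^ α < 1 := Real.rpow_lt_one hq0.le hq2 hα
        refine Summable.of_nonneg_of_le (fun k => by positivity) (fun k => ?_)
          ((summable_geometric_of_lt_one (by positivity) hqα).mul_left ((3 * (C₁ * ‖d K‖)) ^ α))
        have h1 := hK (k + K) (by omega)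
        rw [Nat.add_sub_cancel] at h1
        calc (3 * ‖d (k + K)‖) ^ α ≤ (3 * (C₁ * ‖d K‖) * q ^ k) ^ α := by
              refine Real.rpow_le_rpow (by positivity) ?_ hα.le
              linarith
          _ = _ := by
              rw [Real.mul_rpow (by positivity) (by positivity), ← Real.rpow_natCast,
                ← Real.rpow_mul hq0.le, mul_comm (k : ℝ), Real.rpow_mul hq0.le, Real.rpow_natCast]
      have hdef : ∀ᶠ k in atTop, ‖d (k + 1) - M (d k)‖ ≤
          γ * L' * 3 * (3 * ‖d k‖) ^ α * ‖d k‖ := by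
        filter_upwards [hstep, hrem, hyd] with k h1 h2 h3
        rw [hak, hbk, hγk, sub_self, sub_self, sub_self, abs_zero, mul_zero, mul_zero, mul_zero,
          add_zero, add_zero, zero_mul, zero_add, abs_of_pos hγ0] at h1
        calc _ ≤ γ * ‖e k‖ := h1
          _ ≤ γ * (L' * ‖y k - z‖ ^ α * ‖y k - z‖) := by gcongr
          _ ≤ γ * (L' * (3 * ‖d k‖) ^ α * (3 * ‖d k‖)) := by gcongr
          _ = _ := by ring
      obtain ⟨C', hC', h'⟩ := exists_rate_of_summable h0 hC0 hC (fun k => by positivity) hsum hdef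
      exact linearRate_of_norm_le (rho_nonneg M) hxd hC' h'

end Iteration

end FBType

theorem theorem4p11 (n : ℕ)
    (F : EuclideanSpace ℝ (Fin n) → ℝ) (R : EuclideanSpace ℝ (Fin n) → EReal) (β : ℝ)
    (hR : FBType.IsGammaZero R) (hF : FBType.IsSmoothConvex F β)
    (ak bk γk : ℕ → ℝ) (x : ℕ → EuclideanSpace ℝ (Fin n))
    (hx : FBType.IsFBSequence F R β ak bk γk x)
    (xstar : EuclideanSpace ℝ (Fin n))
    (hmin : IsMinOn (FBType.objective F R) Set.univ xstar)
    (hconv : Filter.Tendsto x Filter.atTop (nhds xstar))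
    (hpoly : FBType.IsLocallyPolyhedral R xstar)
    (hC2 : ContDiffAt ℝ 2 F xstar)
    (hND : -gradient F xstar ∈ intrinsicInterior ℝ (FBType.subdiff R xstar))
    (hRI : (FBType.hessian F xstar).toLinearMap.ker ⊓ FBType.tangent R xstar = ⊥)
    (a b γ : ℝ)
    (ha : Filter.Tendsto ak Filter.atTop (nhds a))
    (hb : Filter.Tendsto bk Filter.atTop (nhds b))
    (hγ : Filter.Tendsto γk Filter.atTop (nhds γ))
    (hab : ¬(a = 1 ∧ b = 0))
    (G : Module.End ℝ (FBType.tangent R xstar))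
    (hG : G = FBType.opG (FBType.tangent R xstar) (FBType.hessian F xstar) γ)
    (hspec : ∀ η : ℝ, Module.End.HasEigenvalue G η → (2 * (b - a) - 1) / (1 + 2 * b) < η)
    (M : Module.End ℝ (FBType.tangent R xstar × FBType.tangent R xstar))
    (hM : M = FBType.opM G a b) :
    FBType.rho M < 1 ∧
    (∀ ρ : ℝ, FBType.rho M < ρ → ρ < 1 → FBType.LinearRate x xstar ρ) ∧
    ((∀ k, ak k = a) → (∀ k, bk k = b) → (∀ k, γk k = γ) →
      (∃ α : ℝ, 0 < α ∧ ∃ L : ℝ, ∀ᶠ y in nhds xstar,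
        ‖FBType.hessian F y - FBType.hessian F xstar‖ ≤ L * ‖y - xstar‖ ^ α) →
      FBType.PeripherallySemisimple M →
      FBType.LinearRate x xstar (FBType.rho M)) := by
  obtain ⟨ε₁, ε₂, hε₁, -, hstep⟩ := hx.step_mem
  exact FBType.rates_of_eventually_recursion hF hx.a_mem hx.b_mem hconv hC2
    (hx.eventually_recursion hR hF hconv hpoly hND) hRI ha hb hγ
    (hε₁.trans_le (ge_of_tendsto' hγ fun k => (hstep k).1)) hab hG hspec hM
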